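/- Theorem. Let $M$ be a loopless matroid on a finite ground set $E$, with set of bases $\mathcal{B}$ and rank function $\operatorname{rank}$. For nonempty $A\subseteq E$ let $\rho(A)=|A|/\operatorname{rank}(A)$ be the density of $A$, and let $\rho=\rho(E)$. Let $P(M)\subset\mathbb{R}^{E}$ be the base polytope of $M$, that is, the convex hull of the indicator vectors $e_B$ of the bases $B\in\mathcal{B}$. A matroid is connected if it is not the direct sum of two matroids on nonempty ground sets, and the connected components of $M$ are the summands in the decomposition of $M$ as a direct sum of connected matroids on nonempty ground sets. A positive measure on $\mathcal{B}$ is given by a real number $\mu(B)>0$ for each $B\in\mathcal{B}$, with $\mu(\mathcal{A})=\sum_{B\in\mathcal{A}}\mu(B)$ for $\mathcal{A}\subseteq\mathcal{B}$. Then the following are equivalent: (1) The point $(\rho^{-1},\dots,\rho^{-1})$ lies in the relative interior of $P(M)$. (2) $\rho(A)\leq\rho(E)$ for all nonempty $A\subseteq E$, with strict inequality whenever $A$ is not a union of ground sets of connected components of $M$. (3) There exists a positive measure $\mu$ on $\mathcal{B}$ such that $\mu(\{B\in\mathcal{B} : e\in B\})$ has the same value for all $e\in E$. A matroid satisfying these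 conditions is called strictly uniformly dense. -/

import Mathlib

namespace Matroid

/-- The density `ρ(A) = |A| / rank(A)` of a set `A` of elements of `M`. The density of the matroid
itself is `M.density M.E`. -/
noncomputable def density {α : Type*} (M : Matroid α) (A : Set α) : ℝ :=
  (A.ncard : ℝ) / ((M.eRk A).toNat : ℝ)

/-- The indicator vector `e_B ∈ ℝ^E` of a set `B`, where `E` is the ground set of `M`. -/
noncomputable def indicatorVector {α : Type*} (M : Matroid α) (B : Set α) : M.E → ℝ :=
  fun e => B.indicator (fun _ => (1 : ℝ)) (e : α)

/-- The base polytope `P(M) ⊆ ℝ^E`: the convex hull of the indicator vectors of the bases. -/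
noncomputable def basePolytope {α : Type*} (M : Matroid α) : Set (M.E → ℝ) :=
  convexHull ℝ {x | ∃ B : Set α, M.IsBase B ∧ x = M.indicatorVector B}

/-- A matroid is connected if it is not the direct sum of two matroids on nonempty
(disjoint) ground sets. -/
def IsConnectedMatroid {α : Type*} (M : Matroid α) : Prop :=
  ¬ ∃ (M₁ M₂ : Matroid α) (h : Disjoint M₁.E M₂.E),
    M₁.E.Nonempty ∧ M₂.E.Nonempty ∧ M = M₁.disjointSum M₂ h

/-- The family `N` is a decomposition of `M` as a direct sum of connected matroids on nonempty,
pairwise disjoint ground sets (whose union is then the ground set of `M`). -/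
def IsConnectedDecomposition {α ι : Type*} (M : Matroid α) (N : ι → Matroid α) : Prop :=
  (∀ i, (N i).E.Nonempty ∧ (N i).IsConnectedMatroid) ∧
    ∃ h : Pairwise (Function.onFun Disjoint fun i => (N i).E), M = Matroid.disjointSigma N h

/-- `K` is a connected component of `M`: a summand in a decomposition of `M` as a direct sum of
connected matroids. -/
def IsConnectedComponent {α : Type*} (M K : Matroid α) : Prop :=
  ∃ (ι : Type) (N : ι → Matroid α), M.IsConnectedDecomposition N ∧ ∃ i, N i = K

/-- `A` is a union of ground sets of connected components of `M`. -/
def IsUnionOfComponents {α : Type*} (M : Matroid α) (A : Set α) : Prop :=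
  ∃ S : Set (Matroid α), (∀ K ∈ S, M.IsConnectedComponent K) ∧ A = ⋃ K ∈ S, K.E

/-- A measure on the set of bases of `M`, given by a nonnegative real number for each basis
(not necessarily normalized). -/
abbrev BasisMeasure {α : Type*} (M : Matroid α) : Type _ :=
  {B : Set α // M.IsBase B} → NNReal

/-- The measure `μ(𝒜) = ∑_{B ∈ 𝒜} μ(B)` of a set `𝒜` of bases
(a matroid on a finite ground set has finitely many bases). -/
noncomputable def BasisMeasure.measureOf {α : Type*} {M : Matroid α} (μ : M.BasisMeasure)
    (𝒜 : Set {B : Set α // M.IsBase B}) : NNReal :=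
  ∑ᶠ B ∈ 𝒜, μ B

/-- A basis measure is positive if every basis has positive measure. -/
def BasisMeasure.IsPositive {α : Type*} {M : Matroid α} (μ : M.BasisMeasure) : Prop :=
  ∀ B, 0 < μ B

/-- A basis measure is `E`-uniform if `μ({B : e ∈ B})` is the same for all elements `e`. -/
def BasisMeasure.IsUniform {α : Type*} {M : Matroid α} (μ : M.BasisMeasure) : Prop :=
  ∀ e ∈ M.E, ∀ f ∈ M.E, μ.measureOf {B | e ∈ B.1} = μ.measureOf {B | f ∈ B.1}

end Matroid

/-! The relative interior of the convex hull of finitely many points is the set of their convex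
combinations with all weights positive (`mem_intrinsicInterior_convexHull_range_iff`). So (1) says
that the constant point is a positive combination of the `e_B`. Rescaling the weights gives (3);
conversely, the common value is forced by summing coordinates, since every base has `rank(E)`
elements. For (1) ⇒ (2), sum coordinates over `A`: `|A|/ρ` is the weighted average of `|B ∩ A| ≤
rank(A)`, with equality iff every base meets `A` in a basis of `A`. This is `SplitsBases`, which
characterises unions of components (`isUnionOfComponents_iff_splitsBases`). For (2) ⇒ (1), Edmonds'
inequalities `x(A) ≤ rank(A)`, `x(E) = rank(E)` place a point in `P(M)`
(`mem_basePolytope_of_sum_le_natRk`). Those tight at the constant point come from splitting sets,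
where every `e_B` is tight too. Hence one can move slightly away from each `e_B` inside `P(M)`,
which gives positive weights. -/

section ConvexHull

/-! ### Relative interior of a polytope. -/

variable {ι V : Type*} [Fintype ι]

lemma mem_convexHull_range_iff_exists_weights [AddCommGroup V] [Module ℝ V] {v : ι → V} {x : V} :
    x ∈ convexHull ℝ (Set.range v) ↔
      ∃ w : ι → ℝ, (∀ i, 0 ≤ w i) ∧ ∑ i, w i = 1 ∧ ∑ i, w i • v i = x := by
  classical
  constructor
  · intro hx
    rw [convexHull_range_eq_exists_affineCombination] at hx
    obtain ⟨s, w, hw₀, hw₁, rfl⟩ := hx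
    refine ⟨fun i => if i ∈ s then w i else 0, fun i => ?_, ?_, ?_⟩
    · dsimp only
      split_ifs with h
      exacts [hw₀ i h, le_rfl]
    · simpa using hw₁
    · rw [Finset.affineCombination_eq_linear_combination _ _ _ hw₁]
      simp [ite_smul]
  · rintro ⟨w, hw₀, hw₁, hx⟩
    exact mem_convexHull_of_exists_fintype w v hw₀ hw₁ (fun i => Set.mem_range_self i) hx

/-- A point from which one can move away from every `v i` without leaving the convex hull of `v`
is a combination of all the `v i` with positive weights. -/
lemma exists_pos_weights_of_forall_exists_add_smul_sub_mem [Nonempty ι] [AddCommGroup V]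
    [Module ℝ V] {v : ι → V} {x : V}
    (h : ∀ i, ∃ ε : ℝ, 0 < ε ∧ x + ε • (x - v i) ∈ convexHull ℝ (Set.range v)) :
    ∃ w : ι → ℝ, (∀ i, 0 < w i) ∧ ∑ i, w i = 1 ∧ ∑ i, w i • v i = x := by
  classical
  have h' : ∀ i, ∃ w : ι → ℝ, (∀ j, 0 ≤ w j) ∧ 0 < w i ∧ ∑ j, w j = 1 ∧ ∑ j, w j • v j = x := by
    intro i
    obtain ⟨ε, hε, hx⟩ := h i
    obtain ⟨u, hu₀, hu₁, hu⟩ := mem_convexHull_range_iff_exists_weights.1 hx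
    have hpos : (0 : ℝ) < 1 + ε := by positivity
    -- Solve `x + ε (x - v i) = ∑ u j • v j` for `x`; the coefficient of `v i` gains `ε`.
    refine ⟨fun j => (1 + ε)⁻¹ * (u j + if j = i then ε else 0), fun j => ?_, ?_, ?_, ?_⟩
    · have := hu₀ j
      dsimp only
      split_ifs <;> positivity
    · have := hu₀ i
      simp only [if_true]
      positivity
    · rw [← Finset.mul_sum, Finset.sum_add_distrib, hu₁]
      simp [hpos.ne']
    · simp only [mul_smul, add_smul, ite_smul, zero_smul]
      rw [← Finset.smul_sum, Finset.sum_add_distrib, hu, Finset.sum_ite_eq', if_pos (by simp),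
        inv_smul_eq_iff₀ hpos.ne']
      module
  choose w hw₀ hwpos hw₁ hwx using h'
  have hc : (Fintype.card ι : ℝ) ≠ 0 := by simp
  have hc' : (0 : ℝ) < Fintype.card ι := by exact_mod_cast Fintype.card_pos
  -- Averaging the representations over `i` makes all weights positive at once.
  refine ⟨fun j => (Fintype.card ι : ℝ)⁻¹ * ∑ i, w i j, fun j => ?_, ?_, ?_⟩
  · have : 0 < ∑ i, w i j :=
      Finset.sum_pos' (fun i _ => hw₀ i j) ⟨j, Finset.mem_univ j, hwpos j⟩
    positivity
  · rw [← Finset.mul_sum, Finset.sum_comm]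
    simp [hw₁]
  · simp only [mul_smul, Finset.sum_smul]
    rw [← Finset.smul_sum, Finset.sum_comm]
    simp only [hwx, Finset.sum_const, Finset.card_univ]
    rw [← Nat.cast_smul_eq_nsmul ℝ, inv_smul_smul₀ hc]

lemma mem_intrinsicInterior_iff_exists_ball [NormedAddCommGroup V] [NormedSpace ℝ V] {s : Set V}
    {x : V} : x ∈ intrinsicInterior ℝ s ↔
      x ∈ s ∧ ∃ δ > 0, ∀ y ∈ affineSpan ℝ s, dist y x < δ → y ∈ s := by
  rw [mem_intrinsicInterior]
  constructor
  · rintro ⟨y, hy, rfl⟩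
    refine ⟨interior_subset (s := ((↑) ⁻¹' s : Set (affineSpan ℝ s))) hy, ?_⟩
    obtain ⟨δ, hδ, h⟩ := Metric.mem_nhds_iff.1 (mem_interior_iff_mem_nhds.1 hy)
    exact ⟨δ, hδ, fun z hz hd => h (show (⟨z, hz⟩ : affineSpan ℝ s) ∈ Metric.ball y δ from hd)⟩
  · rintro ⟨hx, δ, hδ, h⟩
    refine ⟨⟨x, subset_affineSpan ℝ s hx⟩, ?_, rfl⟩
    rw [mem_interior_iff_mem_nhds, Metric.mem_nhds_iff]
    exact ⟨δ, hδ, fun z hz => h z z.2 hz⟩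

lemma Convex.add_smul_mem_intrinsicInterior [NormedAddCommGroup V] [NormedSpace ℝ V] {s : Set V}
    (hs : Convex ℝ s) {y q : V} (hy : y ∈ s) (hq : q ∈ intrinsicInterior ℝ s) {t : ℝ} (ht : 0 < t)
    (ht' : t ≤ 1) : (1 - t) • y + t • q ∈ intrinsicInterior ℝ s := by
  rw [mem_intrinsicInterior_iff_exists_ball] at hq ⊢
  obtain ⟨hqs, δ, hδ, h⟩ := hq
  have hx : (1 - t) • y + t • q ∈ s := hs hy hqs (by linarith) ht.le (by ring)
  refine ⟨hx, t * δ, by positivity, fun z hz hd => ?_⟩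
  -- The homothety with centre `y` and ratio `t` maps the `δ`-ball at `q` onto the `t * δ`-ball at
  -- the new point; this is the preimage of `z`.
  have hq' : q + t⁻¹ • (z - ((1 - t) • y + t • q)) ∈ s := by
    refine h _ ?_ ?_
    · have := (affineSpan ℝ s).smul_vsub_vadd_mem t⁻¹ hz (subset_affineSpan ℝ s hx)
        (subset_affineSpan ℝ s hqs)
      rwa [vsub_eq_sub, vadd_eq_add, add_comm] at this
    · rw [dist_eq_norm] at hd ⊢
      rw [add_sub_cancel_left, norm_smul, norm_inv, Real.norm_of_nonneg ht.le,
        inv_mul_lt_iff₀ ht]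
      exact hd
  have := hs hy hq' (by linarith : 0 ≤ 1 - t) ht.le (by ring)
  rw [smul_add, smul_inv_smul₀ ht.ne'] at this
  convert this using 1
  abel

/-- The relative interior of the convex hull of finitely many points consists of their convex
combinations with positive weights. -/
theorem mem_intrinsicInterior_convexHull_range_iff [Nonempty ι] [NormedAddCommGroup V]
    [NormedSpace ℝ V] [FiniteDimensional ℝ V] {v : ι → V} {x : V} :
    x ∈ intrinsicInterior ℝ (convexHull ℝ (Set.range v)) ↔
      ∃ w : ι → ℝ, (∀ i, 0 < w i) ∧ ∑ i, w i = 1 ∧ ∑ i, w i • v i = x := by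
  classical
  have hconv := convex_convexHull ℝ (Set.range v)
  constructor
  · intro hx
    refine exists_pos_weights_of_forall_exists_add_smul_sub_mem fun i => ?_
    rw [mem_intrinsicInterior_iff_exists_ball] at hx
    obtain ⟨hxs, δ, hδ, h⟩ := hx
    have hpos : 0 < 1 + ‖x - v i‖ := by positivity
    refine ⟨δ / (1 + ‖x - v i‖), by positivity, h _ ?_ ?_⟩
    · have := (affineSpan ℝ (convexHull ℝ (Set.range v))).smul_vsub_vadd_mem
        (δ / (1 + ‖x - v i‖)) (subset_affineSpan ℝ _ hxs)
        (subset_affineSpan ℝ _ (subset_convexHull ℝ _ (Set.mem_range_self i)))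
        (subset_affineSpan ℝ _ hxs)
      rwa [vsub_eq_sub, vadd_eq_add, add_comm] at this
    · rw [dist_eq_norm, add_sub_cancel_left, norm_smul, Real.norm_of_nonneg (by positivity),
        div_mul_eq_mul_div, div_lt_iff₀ hpos]
      nlinarith
  · rintro ⟨w, hw₀, hw₁, rfl⟩
    obtain ⟨q, hq⟩ := ((Set.range_nonempty v).convexHull (𝕜 := ℝ)).intrinsicInterior hconv
    obtain ⟨u, hu₀, hu₁, hu⟩ :=
      mem_convexHull_range_iff_exists_weights.1 (intrinsicInterior_subset hq)
    obtain ⟨i₀, -, hi₀⟩ := Finset.exists_min_image Finset.univ w Finset.univ_nonempty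
    -- Subtracting `t • q` from `x` must leave nonnegative weights `w i - t * u i`, hence `t ≤ min
    -- w`; the bound `2⁻¹` keeps `1 - t` positive.
    set t : ℝ := min (w i₀) 2⁻¹
    have ht : 0 < t := lt_min (hw₀ i₀) (by norm_num)
    have ht' : t ≤ 2⁻¹ := min_le_right _ _
    have ht1 : 0 < 1 - t := by norm_num at ht'; linarith
    have hu_le : ∀ i, u i ≤ 1 := fun i =>
      hu₁ ▸ Finset.single_le_sum (fun j _ => hu₀ j) (Finset.mem_univ i)
    have hy : ∑ i, ((1 - t)⁻¹ * (w i - t * u i)) • v i ∈ convexHull ℝ (Set.range v) := by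
      refine mem_convexHull_range_iff_exists_weights.2 ⟨_, fun i => ?_, ?_, rfl⟩
      · have h1 : t ≤ w i := (min_le_left _ _).trans (hi₀ i (Finset.mem_univ i))
        have : 0 ≤ w i - t * u i := by nlinarith [hu_le i]
        positivity
      · rw [← Finset.mul_sum, Finset.sum_sub_distrib, ← Finset.mul_sum, hw₁, hu₁, mul_one,
          inv_mul_cancel₀ ht1.ne']
    have := hconv.add_smul_mem_intrinsicInterior hy hq ht (by linarith)
    convert this using 1
    simp only [mul_smul, ← Finset.smul_sum, sub_smul (w _), Finset.sum_sub_distrib]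
    rw [smul_inv_smul₀ ht1.ne', hu]
    abel

end ConvexHull

namespace Matroid

open Set

/-- The rank of a set of elements of a matroid, as a natural number. -/
noncomputable def natRk {α : Type*} (M : Matroid α) (A : Set α) : ℕ := (M.eRk A).toNat

/-! ### Ranks as natural numbers. -/

section Rank

variable {α : Type*} {M : Matroid α} {A B I : Set α}

lemma IsBasis.ncard_eq_natRk (h : M.IsBasis I A) : I.ncard = M.natRk A := by
  rw [natRk, ← h.encard_eq_eRk, ncard_def]

lemma IsBase.ncard_eq_natRk (h : M.IsBase B) : B.ncard = M.natRk M.E :=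
  h.isBasis_ground.ncard_eq_natRk

lemma Indep.ncard_le_natRk [M.RankFinite] (h : M.Indep I) (hIA : I ⊆ A) :
    I.ncard ≤ M.natRk A :=
  ENat.toNat_le_toNat (h.encard_le_eRk_of_subset hIA) (eRk_ne_top_iff.2 (M.isRkFinite_set A))

lemma Indep.isBasis_of_ncard_eq_natRk [M.Finite] (h : M.Indep I) (hIA : I ⊆ A) (hA : A ⊆ M.E)
    (hc : I.ncard = M.natRk A) : M.IsBasis I A := by
  have hIfin : I.Finite := M.set_finite I (hIA.trans hA)
  refine h.isBasis_of_eRk_ge hIfin hIA ?_ hA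
  rw [h.eRk_eq_encard, ← hIfin.cast_ncard_eq, hc, natRk,
    ENat.natCast_toNat (eRk_ne_top_iff.2 (M.isRkFinite_set A))]

lemma natRk_pos [M.RankFinite] [M.Loopless] (hA : A.Nonempty) (hAE : A ⊆ M.E) :
    0 < M.natRk A := by
  obtain ⟨e, he⟩ := hA
  have h : M.Indep {e} := (M.isNonloop_of_loopless (hAE he)).indep
  have := h.ncard_le_natRk (singleton_subset_iff.2 he)
  rwa [ncard_singleton] at this

lemma IsBase.ncard_inter_add_ncard_inter_diff [M.Finite] (hB : M.IsBase B) (A : Set α) :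
    (B ∩ A).ncard + (B ∩ (M.E \ A)).ncard = M.natRk M.E := by
  have : B ∩ (M.E \ A) = B \ A := by
    ext e
    have : e ∈ B → e ∈ M.E := fun he => hB.subset_ground he
    simp only [mem_inter_iff, mem_sdiff]
    tauto
  rw [this, ncard_inter_add_ncard_sdiff_eq_ncard _ _ (M.set_finite B hB.subset_ground),
    hB.ncard_eq_natRk]

end Rank

/-! ### Edmonds' description of the base polytope, by the greedy algorithm. -/

section BasePolytope

variable {α : Type*} {M : Matroid α}

lemma ncard_val_image (T : Finset M.E) : ((↑) '' (T : Set M.E) : Set α).ncard = T.card := by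
  rw [ncard_image_of_injective _ Subtype.val_injective, ncard_coe_finset]

/-- Elements enter in order of nonincreasing weight, so `I` is the greedy basis. Letting the shift
`c` vary makes the induction work: with `c = w a` the newest element `a` contributes nothing, and
the remaining multiple of `x(insert a S)` is bounded by the rank. -/
lemma exists_greedy_isBasis (w : M.E → ℝ) (S : Finset M.E) :
    ∃ I : Finset M.E, M.IsBasis ((↑) '' (I : Set M.E)) ((↑) '' (S : Set M.E)) ∧
      ∀ x : M.E → ℝ, (∀ T : Finset M.E, ∑ e ∈ T, x e ≤ M.natRk ((↑) '' (T : Set M.E))) →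
        ∀ c : ℝ, (∀ e ∈ S, c ≤ w e) → ∑ e ∈ S, (w e - c) * x e ≤ ∑ e ∈ I, (w e - c) := by
  classical
  induction S using Finset.induction_on_min_value w with
  | empty => exact ⟨∅, by simp, by simp⟩
  | insert a S ha hmin ih =>
    obtain ⟨I, hI, hIx⟩ := ih
    have hIS : I ⊆ S := by
      have := hI.subset
      rwa [image_subset_image_iff Subtype.val_injective, Finset.coe_subset] at this
    have hSE : ((↑) '' ((insert a S : Finset M.E) : Set M.E) : Set α) ⊆ M.E := by
      rintro _ ⟨e, -, rfl⟩
      exact e.2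
    obtain ⟨J, hJ, hIJ⟩ := hI.indep.subset_isBasis_of_subset
      (hI.subset.trans (image_mono (Finset.coe_subset.2 (Finset.subset_insert a S)))) hSE
    obtain ⟨J, rfl⟩ : ∃ J' : Finset M.E, ((↑) '' (J' : Set M.E) : Set α) = J := by
      refine ⟨(insert a S).filter fun e => (e : α) ∈ J, ?_⟩
      ext e
      constructor
      · rintro ⟨f, hf, rfl⟩
        exact (Finset.mem_filter.1 hf).2
      · intro he
        obtain ⟨f, hf, rfl⟩ := hJ.subset he
        exact ⟨f, Finset.mem_filter.2 ⟨hf, he⟩, rfl⟩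
    rw [image_subset_image_iff Subtype.val_injective, Finset.coe_subset] at hIJ
    have hJS : J ⊆ insert a S := by
      have := hJ.subset
      rwa [image_subset_image_iff Subtype.val_injective, Finset.coe_subset] at this
    have hJI : ∀ e ∈ J, e ∉ I → e = a := by
      intro e heJ heI
      by_contra hea
      have heS : e ∈ S := (Finset.mem_insert.1 (hJS heJ)).resolve_left hea
      refine heI ?_
      have h := hI.mem_of_insert_indep (mem_image_of_mem _ heS) (hJ.indep.subset ?_)
      · obtain ⟨f, hf, hfe⟩ := h
        rwa [← Subtype.val_injective hfe]
      · exact insert_subset (mem_image_of_mem _ heJ) (image_mono (Finset.coe_subset.2 hIJ))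
    refine ⟨J, hJ, fun x hx c hc => ?_⟩
    have hca : c ≤ w a := hc a (Finset.mem_insert_self a S)
    have hcard : (J.card : ℝ) = M.natRk ((↑) '' ((insert a S : Finset M.E) : Set M.E)) := by
      rw [← hJ.ncard_eq_natRk, ncard_val_image]
    have hJsum : ∑ e ∈ J, (w e - w a) = ∑ e ∈ I, (w e - w a) :=
      (Finset.sum_subset hIJ fun e heJ heI => by rw [hJI e heJ heI, sub_self]).symm
    calc ∑ e ∈ insert a S, (w e - c) * x e
        = ∑ e ∈ insert a S, (w e - w a) * x e + (w a - c) * ∑ e ∈ insert a S, x e := by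
          rw [Finset.mul_sum, ← Finset.sum_add_distrib]
          exact Finset.sum_congr rfl fun e _ => by ring
      _ = ∑ e ∈ S, (w e - w a) * x e + (w a - c) * ∑ e ∈ insert a S, x e := by
          rw [Finset.sum_insert ha (f := fun e => (w e - w a) * x e)]
          simp
      _ ≤ ∑ e ∈ J, (w e - w a) + (w a - c) * J.card := by
          rw [hcard, hJsum]
          exact add_le_add (hIx x hx _ hmin)
            (mul_le_mul_of_nonneg_left (hx _) (sub_nonneg.2 hca))
      _ = ∑ e ∈ J, (w e - c) := by
          simp only [Finset.sum_sub_distrib, Finset.sum_const, nsmul_eq_mul]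
          ring

lemma basePolytope_eq_convexHull_range (M : Matroid α) :
    M.basePolytope =
      convexHull ℝ (range fun B : {B : Set α // M.IsBase B} => M.indicatorVector B.1) := by
  unfold basePolytope
  congr 1
  ext x
  simp [eq_comm]

instance finite_isBase_subtype [M.Finite] : Finite {B : Set α // M.IsBase B} :=
  (M.ground_finite.finite_subsets.subset fun _ hB => IsBase.subset_ground hB).to_subtype

instance finite_coe_ground [M.Finite] : Finite M.E := M.ground_finite.to_subtype

lemma sum_indicatorVector (B : Set α) (T : Finset M.E) :
    ∑ e ∈ T, M.indicatorVector B e = ((B ∩ (↑) '' (T : Set M.E)).ncard : ℝ) := by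
  classical
  have : B ∩ (↑) '' (T : Set M.E) =
      (↑) '' ((T.filter fun e => (e : α) ∈ B : Finset M.E) : Set M.E) := by
    ext e
    simp only [mem_inter_iff, mem_image, Finset.mem_coe, Finset.mem_filter]
    constructor
    · rintro ⟨he, f, hf, rfl⟩
      exact ⟨f, ⟨hf, he⟩, rfl⟩
    · rintro ⟨f, ⟨hf, he⟩, rfl⟩
      exact ⟨he, f, hf, rfl⟩
  rw [this, ncard_val_image]
  simp [indicatorVector, indicator_apply]

/-- A point of `ℝ^E` that satisfies the rank inequalities lies in the base polytope. -/
theorem mem_basePolytope_of_sum_le_natRk [M.Finite] [Fintype M.E] {x : M.E → ℝ}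
    (hx : ∀ T : Finset M.E, ∑ e ∈ T, x e ≤ M.natRk ((↑) '' (T : Set M.E)))
    (hxE : ∑ e, x e = M.natRk M.E) : x ∈ M.basePolytope := by
  classical
  by_contra hxP
  rw [basePolytope_eq_convexHull_range] at hxP
  -- A functional separating `x` from the polytope is contradicted by the greedy base for its
  -- coefficients `w`. The shift `c` cancels because `x` and the base vector have the same
  -- coordinate sum.
  obtain ⟨f, u, hfu, hux⟩ := geometric_hahn_banach_closed_point (convex_convexHull ℝ _)
    ((finite_range _).isCompact_convexHull ℝ).isClosed hxP
  set w : M.E → ℝ := fun e => f (Pi.single e 1) with hw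
  have hf : ∀ y : M.E → ℝ, f y = ∑ e, w e * y e := by
    intro y
    have := (f : (M.E → ℝ) →ₗ[ℝ] ℝ).pi_apply_eq_sum_univ y
    simp only [ContinuousLinearMap.coe_coe, smul_eq_mul] at this
    rw [this]
    refine Finset.sum_congr rfl fun e _ => ?_
    rw [hw, mul_comm]
    congr 2
    ext j
    simp [Pi.single_apply, eq_comm]
  obtain ⟨I, hI, hIx⟩ := exists_greedy_isBasis w Finset.univ
  have huniv : ((↑) '' ((Finset.univ : Finset M.E) : Set M.E) : Set α) = M.E := by simp
  rw [huniv] at hI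
  have hIB := isBasis_ground_iff.1 hI
  obtain ⟨c, hc⟩ := (finite_range w).bddBelow
  have h1 := hIx x hx c fun e _ => hc (mem_range_self e)
  have h2 := hfu _ (subset_convexHull ℝ _
    (mem_range_self (⟨_, hIB⟩ : {B : Set α // M.IsBase B})))
  have h3 : f (M.indicatorVector ((↑) '' (I : Set M.E))) = ∑ e ∈ I, w e := by
    rw [hf]
    simp [indicatorVector, indicator_apply]
  have h4 : (I.card : ℝ) = M.natRk M.E := by rw [← hI.ncard_eq_natRk, ncard_val_image]
  simp only [sub_mul, Finset.sum_sub_distrib, ← Finset.mul_sum, hxE, Finset.sum_const,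
    nsmul_eq_mul, h4] at h1
  rw [hf] at hux
  rw [h3] at h2
  linarith

end BasePolytope

end Matroid

namespace Matroid

open Set

/-! ### Unions of connected components as sets that split every base. -/

section Components

variable {α : Type*} {M : Matroid α} {A B : Set α}

/-- Every base of `M` meets `A` in a basis of `A`. For finite matroids this says that `M` is the
direct sum of its restrictions to `A` and to the complement of `A`. -/
def SplitsBases (M : Matroid α) (A : Set α) : Prop :=
  ∀ B, M.IsBase B → M.IsBasis (B ∩ A) A

lemma SplitsBases.subset_ground (h : M.SplitsBases A) : A ⊆ M.E := by
  obtain ⟨B, hB⟩ := M.exists_isBase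
  exact (h B hB).subset_ground

/-- Extend a basis of the complement to a base and count that base on both sides. -/
lemma SplitsBases.natRk_add_natRk_diff [M.Finite] (h : M.SplitsBases A) :
    M.natRk A + M.natRk (M.E \ A) = M.natRk M.E := by
  obtain ⟨J, hJ⟩ := M.exists_isBasis (M.E \ A)
  obtain ⟨B, hB, rfl⟩ := hJ.exists_isBase
  rw [← hB.ncard_inter_add_ncard_inter_diff A, (h B hB).ncard_eq_natRk, hJ.ncard_eq_natRk]

lemma SplitsBases.diff [M.Finite] (h : M.SplitsBases A) : M.SplitsBases (M.E \ A) := by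
  intro B hB
  refine (hB.indep.inter_right _).isBasis_of_ncard_eq_natRk inter_subset_right sdiff_subset ?_
  have h1 := hB.ncard_inter_add_ncard_inter_diff A
  rw [(h B hB).ncard_eq_natRk, ← h.natRk_add_natRk_diff] at h1
  exact Nat.add_left_cancel h1

lemma SplitsBases.eq_disjointSum [M.Finite] (h : M.SplitsBases A)
    (hd : Disjoint (M ↾ A).E (M ↾ (M.E \ A)).E) :
    M = (M ↾ A).disjointSum (M ↾ (M.E \ A)) hd := by
  have hA := h.subset_ground
  have hE : A ∪ (M.E \ A) = M.E := union_sdiff_cancel hA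
  refine ext_isBase (by simp [hE]) fun B hBE => ?_
  simp only [disjointSum_isBase_iff, restrict_ground_eq, isBase_restrict_iff hA,
    isBase_restrict_iff (sdiff_subset : M.E \ A ⊆ M.E), hE]
  refine ⟨fun hB => ⟨h B hB, h.diff B hB, hBE⟩, fun ⟨h1, h2, _⟩ => ?_⟩
  have hBu : B ∩ A ∪ B ∩ (M.E \ A) = B := by
    rw [← inter_union_distrib_left, hE, inter_eq_self_of_subset_left hBE]
  -- `B'` is a base with the same trace as `B` outside `A`. Inside `A` both traces are bases of `A`,
  -- so `B` has the rank and the size of `B'`.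
  obtain ⟨B', hB', hJ⟩ := h2.exists_isBase
  have hBu' : B' ∩ A ∪ B' ∩ (M.E \ A) = B' := by
    rw [← inter_union_distrib_left, hE, inter_eq_self_of_subset_left hB'.subset_ground]
  have hr : M.eRk B = M.eRank := by
    rw [← hBu, h1.eRk_eq_eRk_union, hJ, ← (h B' hB').eRk_eq_eRk_union, hBu', hB'.eRk_eq_eRank]
  have hdisj : ∀ X : Set α, Disjoint (X ∩ A) (X ∩ (M.E \ A)) := fun X =>
    disjoint_sdiff_right.mono inter_subset_right inter_subset_right
  have hc : B.encard = M.eRank := by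
    rw [← hBu, encard_union_eq (hdisj B), h1.encard_eq_eRk, hJ, ← (h B' hB').encard_eq_eRk,
      ← encard_union_eq (hdisj B'), hBu', hB'.encard_eq_eRank]
  have hfin := M.set_finite B hBE
  exact ((indep_iff_eRk_eq_encard_of_finite hfin).2 (hr.trans hc.symm)).isBase_of_eRk_ge hfin hr.ge

lemma IsConnectedDecomposition.disjointSum {ι₁ ι₂ : Type*} {M₁ M₂ : Matroid α}
    {N₁ : ι₁ → Matroid α} {N₂ : ι₂ → Matroid α} (h₁ : M₁.IsConnectedDecomposition N₁)
    (h₂ : M₂.IsConnectedDecomposition N₂) (h : Disjoint M₁.E M₂.E) :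
    (M₁.disjointSum M₂ h).IsConnectedDecomposition (Sum.elim N₁ N₂) := by
  obtain ⟨hc₁, hd₁, rfl⟩ := h₁
  obtain ⟨hc₂, hd₂, rfl⟩ := h₂
  have hsub₁ : ∀ i, (N₁ i).E ⊆ (Matroid.disjointSigma N₁ hd₁).E := fun i => by
    rw [disjointSigma_ground_eq]
    exact subset_iUnion (fun i => (N₁ i).E) i
  have hsub₂ : ∀ i, (N₂ i).E ⊆ (Matroid.disjointSigma N₂ hd₂).E := fun i => by
    rw [disjointSigma_ground_eq]
    exact subset_iUnion (fun i => (N₂ i).E) i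
  have hd : Pairwise (Function.onFun Disjoint fun i => (Sum.elim N₁ N₂ i).E) := by
    rintro (i | i) (j | j) hij
    · exact hd₁ fun h => hij (congrArg Sum.inl h)
    · exact h.mono (hsub₁ i) (hsub₂ j)
    · exact h.symm.mono (hsub₂ i) (hsub₁ j)
    · exact hd₂ fun h => hij (congrArg Sum.inr h)
  refine ⟨fun i => by cases i <;> simp [hc₁, hc₂], hd, ?_⟩
  refine ext_isBase (by simp [iUnion_sum]) fun B _ => ?_
  have e₁ : ∀ i, B ∩ (Matroid.disjointSigma N₁ hd₁).E ∩ (N₁ i).E = B ∩ (N₁ i).E := fun i => by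
    rw [inter_assoc, inter_eq_self_of_subset_right (hsub₁ i)]
  have e₂ : ∀ i, B ∩ (Matroid.disjointSigma N₂ hd₂).E ∩ (N₂ i).E = B ∩ (N₂ i).E := fun i => by
    rw [inter_assoc, inter_eq_self_of_subset_right (hsub₂ i)]
  rw [disjointSum_isBase_iff, disjointSigma_isBase_iff, disjointSigma_isBase_iff,
    disjointSigma_isBase_iff]
  simp only [e₁, e₂]
  simp only [Sum.forall, Sum.elim_inl, Sum.elim_inr, iUnion_sum,
    disjointSigma_ground_eq, inter_subset_right, and_true]
  tauto

lemma exists_isConnectedDecomposition (M : Matroid α) [hM : M.Finite] :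
    ∃ (ι : Type) (N : ι → Matroid α), M.IsConnectedDecomposition N := by
  induction hn : M.E.ncard using Nat.strong_induction_on generalizing M with
  | _ n ih =>
    subst hn
    rcases M.E.eq_empty_or_nonempty with hE | hE
    · have hd : Pairwise (Function.onFun Disjoint fun i : Empty => (i.elim : Matroid α).E) :=
        fun i => i.elim
      refine ⟨Empty, fun i => i.elim, fun i => i.elim, hd, ?_⟩
      rw [ground_eq_empty_iff.1 hE, eq_comm, ← ground_eq_empty_iff]
      simp
    by_cases hc : M.IsConnectedMatroid
    · have hd : Pairwise (Function.onFun Disjoint fun _ : Unit => M.E) :=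
        fun i j hij => (hij rfl).elim
      have hU : ⋃ _ : Unit, M.E = M.E := iUnion_const M.E
      refine ⟨Unit, fun _ => M, fun _ => ⟨hE, hc⟩, hd, ?_⟩
      refine ext_isBase (by simp [hU]) fun B hB => ?_
      simp [hB, hU, inter_eq_self_of_subset_left hB]
    · obtain ⟨M₁, M₂, h, hne₁, hne₂, rfl⟩ := not_not.1 hc
      have hfin := hM.ground_finite
      rw [disjointSum_ground_eq] at hfin
      have hfin₁ := hfin.subset subset_union_left
      have hfin₂ := hfin.subset subset_union_right
      have hcard : (M₁.disjointSum M₂ h).E.ncard = M₁.E.ncard + M₂.E.ncard := by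
        rw [disjointSum_ground_eq, ncard_union_eq h hfin₁ hfin₂]
      have hp₁ := (ncard_pos hfin₁).2 hne₁
      have hp₂ := (ncard_pos hfin₂).2 hne₂
      obtain ⟨ι₁, N₁, h₁⟩ := ih _ (by omega) M₁ (hM := ⟨hfin₁⟩) rfl
      obtain ⟨ι₂, N₂, h₂⟩ := ih _ (by omega) M₂ (hM := ⟨hfin₂⟩) rfl
      exact ⟨_, _, h₁.disjointSum h₂ h⟩

/-- Decomposing both restrictions separately and joining the families gives a decomposition of `M`
whose first family covers `A`; uniqueness of decompositions is not needed. -/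
lemma SplitsBases.isUnionOfComponents [M.Finite] (h : M.SplitsBases A) :
    M.IsUnionOfComponents A := by
  have hA := h.subset_ground
  have : (M ↾ A).Finite := ⟨M.set_finite A hA⟩
  have : (M ↾ (M.E \ A)).Finite := ⟨M.set_finite _ sdiff_subset⟩
  obtain ⟨ι₁, N₁, h₁⟩ := (M ↾ A).exists_isConnectedDecomposition
  obtain ⟨ι₂, N₂, h₂⟩ := (M ↾ (M.E \ A)).exists_isConnectedDecomposition
  have hdisj : Disjoint (M ↾ A).E (M ↾ (M.E \ A)).E := disjoint_sdiff_right
  have hd := h₁.disjointSum h₂ hdisj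
  rw [← h.eq_disjointSum] at hd
  refine ⟨range N₁, ?_, ?_⟩
  · rintro _ ⟨i, rfl⟩
    exact ⟨_, _, hd, Sum.inl i, rfl⟩
  · obtain ⟨-, hp, he⟩ := h₁
    have := congrArg Matroid.E he
    rw [restrict_ground_eq, disjointSigma_ground_eq] at this
    rw [this, biUnion_range]

lemma IsConnectedComponent.splitsBases {K : Matroid α} (h : M.IsConnectedComponent K) :
    M.SplitsBases K.E := by
  obtain ⟨ι, N, ⟨-, hd, rfl⟩, i, rfl⟩ := h
  intro B hB
  rw [disjointSigma_isBase_iff] at hB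
  refine disjointSigma_isBasis_iff.2
    ⟨fun j => ?_, inter_subset_right, subset_iUnion (fun i => (N i).E) i⟩
  obtain rfl | hij := eq_or_ne i j
  · rw [inter_assoc, inter_self, isBasis_ground_iff]
    exact hB.1 i
  · rw [inter_assoc, (hd hij).inter_eq, inter_empty]
    exact (N j).empty_indep.isBasis_self

lemma isUnionOfComponents_iff_splitsBases [M.Finite] :
    M.IsUnionOfComponents A ↔ M.SplitsBases A := by
  refine ⟨?_, SplitsBases.isUnionOfComponents⟩
  rintro ⟨S, hS, rfl⟩ B hB
  rw [biUnion_eq_iUnion, inter_iUnion]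
  -- Splitting passes to unions, because the union of the traces is still part of the base `B`.
  refine IsBasis.iUnion_isBasis_iUnion _ _ (fun K => (hS K.1 K.2).splitsBases B hB) ?_
  rw [← inter_iUnion]
  exact hB.indep.inter_right _

end Components

end Matroid

namespace Matroid

open Set Filter Topology

/-! ### The equivalences. -/

section StrictlyUniformlyDense

variable {α : Type*} {M : Matroid α} {A : Set α}

instance nonempty_isBase_subtype : Nonempty {B : Set α // M.IsBase B} :=
  nonempty_subtype.2 M.exists_isBase

lemma density_eq_ncard_div_natRk (M : Matroid α) (A : Set α) :
    M.density A = A.ncard / M.natRk A := rfl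

lemma density_pos [M.Finite] [M.Loopless] (hA : A.Nonempty) (hAE : A ⊆ M.E) :
    0 < M.density A := by
  have h1 := natRk_pos hA hAE
  have h2 := (ncard_pos (M.set_finite A hAE)).2 hA
  rw [density_eq_ncard_div_natRk]
  positivity

lemma density_le_iff [M.Finite] [M.Loopless] (hA : A.Nonempty) (hAE : A ⊆ M.E) :
    M.density A ≤ M.density M.E ↔ A.ncard * (M.density M.E)⁻¹ ≤ M.natRk A := by
  have h1 : (0 : ℝ) < M.natRk A := by exact_mod_cast natRk_pos hA hAE
  rw [mul_inv_le_iff₀ (density_pos (hA.mono hAE) subset_rfl), density_eq_ncard_div_natRk M A,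
    div_le_iff₀ h1, mul_comm]

lemma density_lt_iff [M.Finite] [M.Loopless] (hA : A.Nonempty) (hAE : A ⊆ M.E) :
    M.density A < M.density M.E ↔ A.ncard * (M.density M.E)⁻¹ < M.natRk A := by
  have h1 : (0 : ℝ) < M.natRk A := by exact_mod_cast natRk_pos hA hAE
  rw [mul_inv_lt_iff₀ (density_pos (hA.mono hAE) subset_rfl), density_eq_ncard_div_natRk M A,
    div_lt_iff₀ h1, mul_comm]

lemma ncard_ground_mul_inv_density [M.Finite] [M.Loopless] :
    M.E.ncard * (M.density M.E)⁻¹ = M.natRk M.E := by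
  rcases M.E.eq_empty_or_nonempty with hE | hE
  · simp [hE, natRk]
  · have h := (ncard_pos M.ground_finite).2 hE
    rw [density_eq_ncard_div_natRk]
    field_simp

lemma BasisMeasure.coe_measureOf [Fintype {B : Set α // M.IsBase B}] (μ : M.BasisMeasure)
    (e : M.E) : (μ.measureOf {B | (e : α) ∈ B.1} : ℝ) = ∑ B, μ B * M.indicatorVector B.1 e := by
  classical
  rw [measureOf, finsum_mem_def, finsum_eq_sum_of_fintype, NNReal.coe_sum]
  refine Finset.sum_congr rfl fun B _ => ?_
  by_cases h : (e : α) ∈ B.1 <;> simp [indicatorVector, indicator, h]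

lemma sum_weight_mul_ncard_inter [Fintype {B : Set α // M.IsBase B}]
    {w : {B : Set α // M.IsBase B} → ℝ} {x : M.E → ℝ}
    (hw : ∑ B, w B • M.indicatorVector B.1 = x) (T : Finset M.E) :
    ∑ e ∈ T, x e = ∑ B, w B * ((B.1 ∩ (↑) '' (T : Set M.E)).ncard : ℝ) := by
  simp only [← sum_indicatorVector, Finset.mul_sum, ← hw, Finset.sum_apply, Pi.smul_apply,
    smul_eq_mul]
  exact Finset.sum_comm

lemma exists_finset_val_image_eq [M.Finite] (hA : A ⊆ M.E) :
    ∃ T : Finset M.E, (↑) '' (T : Set M.E) = A := by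
  refine ⟨(toFinite {e : M.E | (e : α) ∈ A}).toFinset, ?_⟩
  ext e
  simp only [Finite.coe_toFinset, mem_image, mem_ofPred_eq, Subtype.exists, exists_and_left,
    exists_prop, exists_eq_right_right]
  exact ⟨fun h => h.1, fun h => ⟨h, hA h⟩⟩

theorem const_mem_intrinsicInterior_iff_exists_isUniform [M.Finite] [M.Loopless] :
    (fun _ : M.E => (M.density M.E)⁻¹) ∈ intrinsicInterior ℝ M.basePolytope ↔
      ∃ μ : M.BasisMeasure, μ.IsPositive ∧ μ.IsUniform := by
  classical
  have := Fintype.ofFinite M.E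
  have := Fintype.ofFinite {B : Set α // M.IsBase B}
  rw [basePolytope_eq_convexHull_range, mem_intrinsicInterior_convexHull_range_iff]
  constructor
  · rintro ⟨w, hw₀, -, hw⟩
    obtain ⟨μ, hμ⟩ : ∃ μ : M.BasisMeasure, ∀ B, (μ B : ℝ) = w B :=
      ⟨fun B => (w B).toNNReal, fun B => Real.coe_toNNReal _ (hw₀ B).le⟩
    refine ⟨μ, fun B => NNReal.coe_pos.1 ((hμ B).symm ▸ hw₀ B), fun e he f hf => ?_⟩
    have key : ∀ e : M.E, (μ.measureOf {B | (e : α) ∈ B.1} : ℝ) = (M.density M.E)⁻¹ := fun e => by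
      rw [BasisMeasure.coe_measureOf]
      simpa [hμ] using congrFun hw e
    exact NNReal.coe_injective ((key ⟨e, he⟩).trans (key ⟨f, hf⟩).symm)
  · rintro ⟨μ, hpos, hunif⟩
    have ht : (0 : ℝ) < ∑ B, (μ B : ℝ) :=
      Finset.sum_pos (fun B _ => hpos B) Finset.univ_nonempty
    have hw₁ : ∑ B, (∑ B, (μ B : ℝ))⁻¹ * μ B = 1 := by
      rw [← Finset.mul_sum, inv_mul_cancel₀ ht.ne']
    refine ⟨fun B => (∑ B, (μ B : ℝ))⁻¹ * μ B, fun B => ?_, hw₁, ?_⟩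
    · have : (0 : ℝ) < μ B := hpos B
      positivity
    · set x := ∑ B : {B : Set α // M.IsBase B},
        ((∑ B, (μ B : ℝ))⁻¹ * μ B) • M.indicatorVector B.1 with hx
      have hxe : ∀ e : M.E, x e = (∑ B, (μ B : ℝ))⁻¹ * μ.measureOf {B | (e : α) ∈ B.1} := by
        intro e
        rw [BasisMeasure.coe_measureOf, Finset.mul_sum, hx, Finset.sum_apply]
        simp [mul_assoc]
      ext e
      have hconst : ∀ f : M.E, x f = x e := fun f => by
        rw [hxe, hxe, hunif f f.2 e e.2]
      -- `x` is constant; its coordinate sum is `rank(E)`, which determines the value.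
      have hsum := sum_weight_mul_ncard_inter hx.symm Finset.univ
      have huniv : ((↑) '' ((Finset.univ : Finset M.E) : Set M.E) : Set α) = M.E := by simp
      have hcard : (Fintype.card M.E : ℝ) = M.E.ncard := by
        rw [← Nat.card_eq_fintype_card, Nat.card_coe_set_eq]
      have hB : ∀ B : {B : Set α // M.IsBase B}, (B.1 ∩ M.E).ncard = M.natRk M.E := fun B => by
        rw [inter_eq_self_of_subset_left B.2.subset_ground, B.2.ncard_eq_natRk]
      simp only [huniv, hB, hconst, ← Finset.sum_mul, hw₁, Finset.sum_const, Finset.card_univ,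
        nsmul_eq_mul, hcard, one_mul, ← ncard_ground_mul_inv_density] at hsum
      have hn : (M.E.ncard : ℝ) ≠ 0 := by
        exact_mod_cast ((ncard_pos M.ground_finite).2 ⟨e, e.2⟩).ne'
      exact mul_left_cancel₀ hn hsum

theorem const_mem_intrinsicInterior_iff_density_le [M.Finite] [M.Loopless] :
    (fun _ : M.E => (M.density M.E)⁻¹) ∈ intrinsicInterior ℝ M.basePolytope ↔
      ∀ A : Set α, A.Nonempty → A ⊆ M.E → M.density A ≤ M.density M.E ∧
        (¬ M.SplitsBases A → M.density A < M.density M.E) := by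
  classical
  have := Fintype.ofFinite M.E
  have := Fintype.ofFinite {B : Set α // M.IsBase B}
  rw [basePolytope_eq_convexHull_range, mem_intrinsicInterior_convexHull_range_iff]
  constructor
  · rintro ⟨w, hw₀, hw₁, hw⟩ A hA hAE
    rw [density_le_iff hA hAE, density_lt_iff hA hAE]
    obtain ⟨T, hT⟩ := exists_finset_val_image_eq hAE
    have hsum := sum_weight_mul_ncard_inter hw T
    rw [hT, Finset.sum_const, nsmul_eq_mul, ← ncard_val_image, hT] at hsum
    have hle : ∀ B : {B : Set α // M.IsBase B}, ((B.1 ∩ A).ncard : ℝ) ≤ M.natRk A := fun B => by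
      exact_mod_cast (B.2.indep.inter_right A).ncard_le_natRk inter_subset_right
    have hr : (M.natRk A : ℝ) = ∑ B, w B * M.natRk A := by rw [← Finset.sum_mul, hw₁, one_mul]
    rw [hsum, hr]
    refine ⟨Finset.sum_le_sum fun B _ => mul_le_mul_of_nonneg_left (hle B) (hw₀ B).le,
      fun hsplit => ?_⟩
    obtain ⟨B, hB, hBA⟩ : ∃ B, M.IsBase B ∧ ¬ M.IsBasis (B ∩ A) A := by
      simpa [SplitsBases] using hsplit
    refine Finset.sum_lt_sum (fun B _ => mul_le_mul_of_nonneg_left (hle B) (hw₀ B).le)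
      ⟨⟨B, hB⟩, Finset.mem_univ _, mul_lt_mul_of_pos_left ((hle _).lt_of_ne fun h => hBA ?_)
        (hw₀ _)⟩
    exact (hB.indep.inter_right A).isBasis_of_ncard_eq_natRk inter_subset_right hAE
      (by exact_mod_cast h)
  · intro h
    set a := (M.density M.E)⁻¹ with ha
    have hle : ∀ A ⊆ M.E, A.ncard * a ≤ M.natRk A := fun A hAE => by
      rcases A.eq_empty_or_nonempty with rfl | hA
      · simp
      · exact (density_le_iff hA hAE).1 (h A hA hAE).1
    -- The inequalities for `A` and its complement add up to an equality for `E`, so each is an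
    -- equality.
    have hsplit : ∀ A, M.SplitsBases A → A.ncard * a = M.natRk A := fun A hA => by
      refine le_antisymm (hle A hA.subset_ground) ?_
      have h1 := hle _ (sdiff_subset : M.E \ A ⊆ M.E)
      have h2 : (M.natRk A : ℝ) + M.natRk (M.E \ A) = M.natRk M.E := by
        exact_mod_cast hA.natRk_add_natRk_diff
      have h3 : (A.ncard : ℝ) + (M.E \ A).ncard = M.E.ncard := by
        have := ncard_sdiff_add_ncard_of_subset hA.subset_ground M.ground_finite
        rw [← this]
        push_cast
        ring
      rw [← ncard_ground_mul_inv_density, ← ha, ← h3] at h2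
      linarith
    refine exists_pos_weights_of_forall_exists_add_smul_sub_mem fun B => ?_
    rw [← basePolytope_eq_convexHull_range]
    have hsum : ∀ (ε : ℝ) (T : Finset M.E),
        ∑ e ∈ T, ((fun _ => a) + ε • ((fun _ => a) - M.indicatorVector B.1) : M.E → ℝ) e =
          ((↑) '' (T : Set M.E) : Set α).ncard * a +
          ε * (((↑) '' (T : Set M.E) : Set α).ncard * a -
            ((B.1 ∩ (↑) '' (T : Set M.E)).ncard : ℝ)) := by
      intro ε T
      simp only [Pi.add_apply, Pi.smul_apply, Pi.sub_apply, smul_eq_mul, Finset.sum_add_distrib,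
        ← Finset.mul_sum, Finset.sum_sub_distrib, sum_indicatorVector, Finset.sum_const,
        nsmul_eq_mul, ncard_val_image]
    have heq : ∀ (ε : ℝ) (T : Finset M.E), M.SplitsBases ((↑) '' (T : Set M.E)) →
        ∑ e ∈ T, ((fun _ => a) + ε • ((fun _ => a) - M.indicatorVector B.1) : M.E → ℝ) e =
          M.natRk ((↑) '' (T : Set M.E)) := by
      intro ε T hT
      rw [hsum, hsplit _ hT, (hT B.1 B.2).ncard_eq_natRk]
      ring
    -- Splitting sets stay tight for every `ε`; the finitely many other constraints are strict at `ε
    -- = 0` and survive for small `ε` by continuity.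
    have hev : ∀ᶠ ε : ℝ in 𝓝[>] 0, ∀ T : Finset M.E,
        ∑ e ∈ T, ((fun _ => a) + ε • ((fun _ => a) - M.indicatorVector B.1) : M.E → ℝ) e ≤
          M.natRk ((↑) '' (T : Set M.E)) := by
      rw [eventually_all]
      intro T
      by_cases hT : M.SplitsBases ((↑) '' (T : Set M.E))
      · exact Eventually.of_forall fun ε => (heq ε T hT).le
      · have hTE : ((↑) '' (T : Set M.E) : Set α) ⊆ M.E := by
          rintro _ ⟨e, -, rfl⟩
          exact e.2
        have hTne : ((↑) '' (T : Set M.E) : Set α).Nonempty := by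
          rw [nonempty_iff_ne_empty]
          intro h0
          exact hT (h0 ▸ fun B _ => by simp)
        have hlt := (density_lt_iff hTne hTE).1 ((h _ hTne hTE).2 hT)
        simp only [hsum]
        have hcont : Continuous fun ε : ℝ => (((↑) '' (T : Set M.E) : Set α).ncard * a +
          ε * (((↑) '' (T : Set M.E) : Set α).ncard * a -
            ((B.1 ∩ (↑) '' (T : Set M.E)).ncard : ℝ))) := by fun_prop
        have := (hcont.tendsto 0).mono_left (nhdsWithin_le_nhds (s := Ioi 0))
        refine (this.eventually_lt_const ?_).mono fun ε hε => hε.le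
        simpa using hlt
    obtain ⟨ε, hε, hε₀⟩ := (hev.and self_mem_nhdsWithin).exists
    refine ⟨ε, hε₀, mem_basePolytope_of_sum_le_natRk hε ?_⟩
    have huniv : ((↑) '' ((Finset.univ : Finset M.E) : Set M.E) : Set α) = M.E := by simp
    have := heq ε Finset.univ (by
      rw [huniv]
      intro B hB
      rw [inter_eq_self_of_subset_left hB.subset_ground]
      exact hB.isBasis_ground)
    rwa [huniv] at this

end StrictlyUniformlyDense

end Matroid

theorem mainTheorem9 {α : Type*} (M : Matroid α) [M.Finite] [M.Loopless] :
    List.TFAE [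
      (fun _ : M.E => (M.density M.E)⁻¹) ∈ intrinsicInterior ℝ M.basePolytope,
      ∀ A : Set α, A.Nonempty → A ⊆ M.E →
        M.density A ≤ M.density M.E ∧
          (¬ M.IsUnionOfComponents A → M.density A < M.density M.E),
      ∃ μ : M.BasisMeasure, μ.IsPositive ∧ μ.IsUniform] := by
  tfae_have 1 ↔ 2 := by
    simp only [Matroid.isUnionOfComponents_iff_splitsBases]
    exact Matroid.const_mem_intrinsicInterior_iff_density_le
  tfae_have 1 ↔ 3 := Matroid.const_mem_intrinsicInterior_iff_exists_isUniform
  tfae_finish
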